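/- Define finite binary words by $X_{-2}=X_{-1}=X_0=0$ and $X_n=X_{n-1}\overline{X_{n-3}}$ for $n\ge 1$, where the overline exchanges $0$ and $1$. The Allouche–Johnson word $\mathbf{ja}=011110\cdots$ is the infinite word having every $X_n$ as a prefix; its positions are numbered from $0$. Let $N_0=1$, $N_1=2$, $N_2=3$, $N_i=N_{i-1}+N_{i-3}$ for $i\ge 3$. A Narayana representation of $m\ge 0$ is a binary string $e_1\cdots e_t$ with $m=\sum_{i=1}^{t}e_iN_{t-i}$ that does not begin with $0$ and contains neither of the blocks $11$, $101$ (for $m=0$ it is the empty string). A finite word $x$ has period $p$, where $1\le p\le |x|$, if deleting its first $p$ letters gives the same word as deleting its last $p$ letters; for nonempty $x$, $\mathrm{per}(x)$ is its smallest period and $\exp(x)=|x|/\mathrm{per}(x)$. The critical exponent of an infinite word is the supremum of $\exp(x)$ over its nonempty factors $x$; its asymptotic critical exponent is $\limsup_{n\to\infty} n/f(n)$, where $f(n)$ is the minimum of $\mathrm{per}(x)$ over its factors $x$ of length $n$. Then: 1. Every integer $m\ge 0$ has exactly one Narayana representation, and $\mathbf{ja}[m]$ is the parity of the number of $1$'s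 in it. 2. The critical exponent of $\mathbf{ja}$ is $4$, and the nonempty factors of exponent $4$ are exactly $0000$ and $1111$. 3. The asymptotic critical exponent of $\mathbf{ja}$ is $2$. 4. Every factor of $\mathbf{ja}$ of length $n$ with a period $p$ satisfies $n\le 2p+2$. 5. There are arbitrarily long factors $x$ of $\mathbf{ja}$ with $|x|=2\,\mathrm{per}(x)+2$. -/

import Mathlib

namespace AlloucheJohnson

/-! ### Words: factors, periods, exponents -/

section Words

variable {α : Type*}

/-- The factor `w[i..i+n-1]` of length `n` of the infinite word `w`. -/
def block (w : ℕ → α) (i n : ℕ) : List α :=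
  (List.range n).map fun k => w (i + k)

/-- `x` is a (finite, possibly empty) factor of the infinite word `w`. -/
def IsFactor (w : ℕ → α) (x : List α) : Prop :=
  ∃ i : ℕ, x = block w i x.length

/-- `p` is a period of the finite word `x`: `1 ≤ p ≤ |x|`, and deleting the first `p` letters
gives the same word as deleting the last `p` letters. -/
def IsPeriod (x : List α) (p : ℕ) : Prop :=
  1 ≤ p ∧ p ≤ x.length ∧ x.drop p = x.take (x.length - p)

/-- The smallest period of `x`. Every nonempty word has its length as a period; the value at the
empty word, which has no period, is irrelevant. -/
noncomputable def per (x : List α) : ℕ :=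
  sInf {p : ℕ | IsPeriod x p}

/-- The exponent `|x| / per(x)` of a nonempty finite word. -/
noncomputable def exponent (x : List α) : ℝ :=
  (x.length : ℝ) / (per x : ℝ)

/-- The critical exponent of an infinite word: the supremum (possibly `∞`, hence in `EReal`) of
the exponents of its nonempty factors. -/
noncomputable def criticalExponent (w : ℕ → α) : EReal :=
  sSup {e : EReal | ∃ x : List α, IsFactor w x ∧ x ≠ [] ∧ e = (exponent x : EReal)}

/-- The smallest among the periods `per x` of the factors `x` of `w` of length `n`
(relevant for `n ≥ 1`). -/
noncomputable def minPer (w : ℕ → α) (n : ℕ) : ℕ :=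
  sInf {p : ℕ | ∃ x : List α, IsFactor w x ∧ x.length = n ∧ p = per x}

/-- The asymptotic critical exponent `limsup n / f(n)`, where `f(n) = minPer w n`. -/
noncomputable def asymptoticCriticalExponent (w : ℕ → α) : EReal :=
  Filter.limsup (fun n : ℕ => (((n : ℝ) / (minPer w n : ℝ) : ℝ) : EReal)) Filter.atTop

end Words

/-! ### Narayana representations -/

/-- The Narayana numbers `1, 2, 3, 4, 6, 9, 13, …`. -/
def narayana : ℕ → ℕ
  | 0 => 1
  | 1 => 2
  | 2 => 3
  | n + 3 => narayana (n + 2) + narayana n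

/-- The integer `∑ e_i N_{t-i}` represented by the binary string `e_1 ⋯ e_t`, most significant
digit first. -/
def narayanaValue : List (Fin 2) → ℕ
  | [] => 0
  | d :: e => (d : ℕ) * narayana e.length + narayanaValue e

/-- `e` is the canonical Narayana representation of `m`: its value is `m`, it does not start
with `0`, and neither `11` nor `101` occurs in it. -/
def IsNarayanaRep (e : List (Fin 2)) (m : ℕ) : Prop :=
  narayanaValue e = m ∧ e.head? ≠ some 0 ∧ ¬ [1, 1] <:+: e ∧ ¬ [1, 0, 1] <:+: e

/-! ### The Allouche–Johnson word -/

/-- Letter-by-letter binary complement. -/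
def complement (x : List (Fin 2)) : List (Fin 2) :=
  x.map fun a => 1 - a

/-- The words `X_{-2} = X_{-1} = X_0 = 0` and `X_n = X_{n-1} \overline{X_{n-3}}` for `n ≥ 1`,
with the index shifted by two: `X k` is `X_{k-2}`. -/
def X : ℕ → List (Fin 2)
  | 0 => [0]
  | 1 => [0]
  | 2 => [0]
  | n + 3 => X (n + 2) ++ complement (X n)

/-- The Allouche–Johnson infinite word, the limit of the words `X k`. Every `X k` is a prefix
of `X (k + 1)`, and `X (n + 2)` has more than `n` letters, so the letter number `n` of the limit
can be read off from it (see `X_isPrefix` below). -/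
def ja (n : ℕ) : Fin 2 :=
  (X (n + 2)).getD n 0

theorem X_ne_nil (k : ℕ) : X k ≠ [] := by
  fun_induction X k <;> simp_all

theorem X_prefix_succ (k : ℕ) : X k <+: X (k + 1) := by
  match k with
  | 0 => exact List.prefix_rfl
  | 1 => exact List.prefix_rfl
  | n + 2 => exact ⟨complement (X n), by rw [X]⟩

theorem X_prefix {j k : ℕ} (h : j ≤ k) : X j <+: X k := by
  induction k, h using Nat.le_induction with
  | base => exact List.prefix_rfl
  | succ k _ ih => exact ih.trans (X_prefix_succ k)

theorem lt_length_X (n : ℕ) : n < (X (n + 2)).length := by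
  induction n with
  | zero => simp [X]
  | succ n ih =>
    have h := List.length_pos_iff.2 (X_ne_nil n)
    rw [X, List.length_append, complement, List.length_map]
    omega

/-- `ja` is the limit of the words `X k`: each of them is a prefix of `ja`. -/
theorem X_isPrefix (k : ℕ) : X k = block ja 0 (X k).length := by
  apply List.ext_getElem
  · simp [block]
  · intro n h₁ h₂
    have h₃ := lt_length_X n
    simp only [block, List.getElem_map, List.getElem_range, Nat.zero_add, ja,
      List.getD_eq_getElem _ _ h₃]
    rcases le_total k (n + 2) with h | h
    · exact (X_prefix h).getElem h₁
    · exact ((X_prefix h).getElem h₃).symm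

end AlloucheJohnson

/-! `ja` is the sequence of first components (signs) of the fixed point `Z` of a substitution on six
letters. The second components (types) make the substitution recognizable: letters of type `1` are
exactly the second letters of images.

Upper bound. Consider a square of `Z` of period `p ≥ 3`, possibly lacking its last letter. If `p ≥
5`, it desubstitutes to such a square with a smaller period, still at least `3`. Periods `3` and `4`
are checked on the factors of length nine. By induction every such square stops at a clash, two
letters of type `0` and opposite sign (`exists_clash`), and opposite signs are visible in `ja`. Five
letters of `ja` determine the middle letter of `Z`, so agreement of `p + 3` letters of `ja` at
distance `p` would produce such a square and also cover its clash. Periods `1` and `2` are checked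
directly, whence `n ≤ 2p + 2`.

Sharpness. Some squares of `Z` are preceded by letters that differ in type only. Substituting three
times reproduces this configuration with a longer period (`exists_square`), and in `ja` the square
gains two letters on the left.

All statements on exponents follow: `2p + 2 ≤ 4p`, with equality only for `p = 1`, while the added
`2` vanishes asymptotically.

Narayana representations. The lengths of the words `X` are the Narayana numbers, so a leading `1`
moves a position from a prefix into its complemented copy and flips the letter. -/

namespace AlloucheJohnson

/-! ### The six-letter fixed point above `ja` -/

/-- Letters of the extended alphabet: the first component is the letter of `ja` below it. -/
abbrev Letter := Fin 2 × Fin 3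

/-- The substitution whose fixed point projects to `ja`. -/
def subst : Letter → List Letter
  | (s, 0) => [(s, 0), (1 - s, 1)]
  | (s, 1) => [(s, 2)]
  | (s, 2) => [(s, 0)]

/-- The substitution on words. -/
def substWord (w : List Letter) : List Letter := w.flatMap subst

/-- Exchange of `0` and `1` on the extended alphabet. -/
def flipLetter (x : Letter) : Letter := (1 - x.1, x.2)

/-- The iterates of the substitution on the letter `(0, 0)`. -/
def W : ℕ → List Letter
  | 0 => [(0, 0)]
  | n + 1 => substWord (W n)

theorem subst_flipLetter (x : Letter) : subst (flipLetter x) = (subst x).map flipLetter := by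
  revert x; decide

theorem substWord_append (v w : List Letter) :
    substWord (v ++ w) = substWord v ++ substWord w := by
  simp [substWord]

theorem substWord_map_flipLetter (w : List Letter) :
    substWord (w.map flipLetter) = (substWord w).map flipLetter := by
  induction w with
  | nil => rfl
  | cons x w ih =>
    have h := subst_flipLetter x
    simp only [substWord, List.map_cons, List.flatMap_cons, List.map_append] at ih ⊢
    rw [ih, h]

/-- The substitution commutes with the sign flip, so the recursion of `X` propagates from its first
instance. -/
theorem W_add_three (n : ℕ) : W (n + 3) = W (n + 2) ++ (W n).map flipLetter := by
  induction n with
  | zero => decide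
  | succ n ih =>
    change substWord (W (n + 3)) = substWord (W (n + 2)) ++ (substWord (W n)).map flipLetter
    rw [ih, substWord_append, substWord_map_flipLetter]

theorem map_fst_W (n : ℕ) : (W n).map Prod.fst = X (n + 2) := by
  induction n using Nat.strong_induction_on with
  | _ n ih =>
    match n with
    | 0 => decide
    | 1 => decide
    | 2 => decide
    | n + 3 =>
      rw [W_add_three, List.map_append, ih (n + 2) (by omega)]
      change _ = X (n + 4) ++ complement (X (n + 2))
      rw [← ih n (by omega)]
      simp [complement, flipLetter]

theorem length_W (n : ℕ) : (W n).length = (X (n + 2)).length := by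
  rw [← map_fst_W, List.length_map]

theorem lt_length_W (n : ℕ) : n < (W n).length := by
  rw [length_W]; exact lt_length_X n

theorem substWord_prefix {v w : List Letter} (h : v <+: w) : substWord v <+: substWord w := by
  obtain ⟨u, rfl⟩ := h
  exact ⟨substWord u, (substWord_append v u).symm⟩

theorem W_prefix_succ (n : ℕ) : W n <+: W (n + 1) := by
  induction n with
  | zero => exact ⟨[(1, 1)], by decide⟩
  | succ n ih => exact substWord_prefix ih

theorem W_prefix {j k : ℕ} (h : j ≤ k) : W j <+: W k := by
  induction k, h using Nat.le_induction with
  | base => exact List.prefix_rfl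
  | succ k _ ih => exact ih.trans (W_prefix_succ k)

/-- The fixed point of the substitution. -/
def Z (n : ℕ) : Letter := (W n).getD n (0, 0)

theorem getElem_W {k n : ℕ} (h : n < (W k).length) : (W k)[n] = Z n := by
  have h₃ := lt_length_W n
  rw [Z, List.getD_eq_getElem _ _ h₃]
  rcases le_total k n with h' | h'
  · exact (W_prefix h').getElem h
  · exact ((W_prefix h').getElem h₃).symm

theorem fst_Z (n : ℕ) : (Z n).1 = ja n := by
  have h : n < (X (n + 2)).length := lt_length_X n
  have h₃ := lt_length_W n
  rw [ja, Z, List.getD_eq_getElem _ _ h, List.getD_eq_getElem _ _ h₃]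
  simp [← map_fst_W]

theorem block_prefix_W {n k : ℕ} (h : n ≤ (W k).length) : block Z 0 n <+: W k := by
  rw [List.prefix_iff_eq_take]
  apply List.ext_getElem
  · simpa [block] using h
  · intro m h₁ h₂
    simp [block, getElem_W]

/-! ### Cutting `Z` into images of letters -/

/-- The position in `Z` at which the image of the letter number `k` of `Z` starts. -/
def cut : ℕ → ℕ
  | 0 => 0
  | k + 1 => cut k + (subst (Z k)).length

theorem substWord_block_succ (k : ℕ) :
    substWord (block Z 0 (k + 1)) = substWord (block Z 0 k) ++ subst (Z k) := by
  simp [substWord, block, List.range_succ]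

theorem length_substWord_block (k : ℕ) : (substWord (block Z 0 k)).length = cut k := by
  induction k with
  | zero => rfl
  | succ k ih => rw [substWord_block_succ, List.length_append, ih, cut]

theorem Z_cut_add (k o : ℕ) (h : o < (subst (Z k)).length) :
    Z (cut k + o) = (subst (Z k))[o] := by
  have hp : substWord (block Z 0 (k + 1)) <+: W (k + 1) :=
    substWord_prefix (block_prefix_W (lt_length_W k))
  have hl : cut k + o < (substWord (block Z 0 (k + 1))).length := by
    rw [length_substWord_block, cut]; omega
  have h₁ := hp.getElem hl
  rw [getElem_W] at h₁
  rw [← h₁]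
  simp only [substWord_block_succ]
  rw [List.getElem_append_right (by rw [length_substWord_block]; omega)]
  simp [length_substWord_block]

theorem length_subst (x : Letter) : (subst x).length = if x.2 = 0 then 2 else 1 := by
  revert x; decide

theorem cut_succ_of_type_zero {k : ℕ} (h : (Z k).2 = 0) : cut (k + 1) = cut k + 2 := by
  rw [cut, length_subst, if_pos h]

theorem cut_succ_of_type_ne_zero {k : ℕ} (h : (Z k).2 ≠ 0) : cut (k + 1) = cut k + 1 := by
  rw [cut, length_subst, if_neg h]

theorem cut_succ_bounds (k : ℕ) : cut k + 1 ≤ cut (k + 1) ∧ cut (k + 1) ≤ cut k + 2 := by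
  rw [cut, length_subst]; split_ifs <;> omega

/-- The first letter of the image of a letter. -/
def firstLetter (x : Letter) : Letter := (x.1, if x.2 = 1 then 2 else 0)

/-- The last letter of the image of a letter. -/
def lastLetter (x : Letter) : Letter := if x.2 = 0 then (1 - x.1, 1) else firstLetter x

theorem getElem?_subst_zero (x : Letter) : (subst x)[0]? = some (firstLetter x) := by
  revert x; decide

theorem getElem?_subst_one (x : Letter) (h : x.2 = 0) : (subst x)[1]? = some (1 - x.1, 1) := by
  revert x; decide

theorem Z_cut (k : ℕ) : Z (cut k) = firstLetter (Z k) := by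
  have h := Z_cut_add k 0 (by rw [length_subst]; split_ifs <;> omega)
  rw [Nat.add_zero, eq_comm, List.getElem_eq_iff, getElem?_subst_zero] at h
  exact (Option.some.inj h).symm

theorem Z_cut_add_one {k : ℕ} (h : (Z k).2 = 0) : Z (cut k + 1) = (1 - (Z k).1, 1) := by
  have h₁ := Z_cut_add k 1 (by rw [length_subst, if_pos h]; omega)
  rw [eq_comm, List.getElem_eq_iff, getElem?_subst_one _ h] at h₁
  exact (Option.some.inj h₁).symm

theorem Z_cut_succ_sub_one (k : ℕ) : Z (cut (k + 1) - 1) = lastLetter (Z k) := by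
  by_cases h : (Z k).2 = 0
  · rw [cut_succ_of_type_zero h, show cut k + 2 - 1 = cut k + 1 by omega, Z_cut_add_one h,
      lastLetter, if_pos h]
  · rw [cut_succ_of_type_ne_zero h, Nat.add_sub_cancel, Z_cut, lastLetter, if_neg h]

/-- Recognizability: the type of a letter alone tells whether an image starts there. -/
theorem type_Z_cut_ne_one (k : ℕ) : (Z (cut k)).2 ≠ 1 := by
  rw [Z_cut, firstLetter]; dsimp only; split_ifs <;> decide

theorem exists_eq_cut (i : ℕ) : ∃ j, i = cut j ∨ (i = cut j + 1 ∧ (Z j).2 = 0) := by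
  induction i with
  | zero => exact ⟨0, Or.inl rfl⟩
  | succ i ih =>
    obtain ⟨j, rfl | ⟨rfl, h⟩⟩ := ih
    · by_cases h : (Z j).2 = 0
      · exact ⟨j, Or.inr ⟨rfl, h⟩⟩
      · exact ⟨j + 1, Or.inl (cut_succ_of_type_ne_zero h).symm⟩
    · exact ⟨j + 1, Or.inl (by rw [cut_succ_of_type_zero h])⟩

theorem exists_eq_cut_of_type_ne_one {i : ℕ} (h : (Z i).2 ≠ 1) : ∃ j, i = cut j := by
  obtain ⟨j, hj | ⟨rfl, h₀⟩⟩ := exists_eq_cut i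
  · exact ⟨j, hj⟩
  · rw [Z_cut_add_one h₀] at h
    exact absurd rfl h

theorem cut_strictMono : StrictMono cut :=
  strictMono_nat_of_lt_succ fun k => (cut_succ_bounds k).1

theorem cut_add_bounds (j n : ℕ) : cut j + n ≤ cut (j + n) ∧ cut (j + n) ≤ cut j + 2 * n := by
  induction n with
  | zero => simp
  | succ n ih =>
    have := cut_succ_bounds (j + n)
    rw [← Nat.add_assoc j n 1]
    omega

/-! ### Factors of length nine of the fixed point -/

/-- A word on the extended alphabet as a number in base `6`, first letter least significant. -/
def encode : List Letter → ℕ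
  | [] => 0
  | x :: w => x.1.val * 3 + x.2.val + 6 * encode w

/-- The word of length `n` with a given code. -/
def decode : ℕ → ℕ → List Letter
  | 0, _ => []
  | n + 1, c => (Fin.ofNat 2 (c / 3), Fin.ofNat 3 c) :: decode n (c / 6)

theorem decode_encode (w : List Letter) : decode w.length (encode w) = w := by
  induction w with
  | nil => rfl
  | cons x w ih =>
    obtain ⟨⟨s, hs⟩, ⟨t, ht⟩⟩ := x
    simp only [encode, List.length_cons, decode, List.cons.injEq, Prod.mk.injEq]
    refine ⟨⟨Fin.ext ?_, Fin.ext ?_⟩, ?_⟩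
    · simp only [Fin.val_ofNat]; omega
    · simp only [Fin.val_ofNat]; omega
    · rw [show (s * 3 + t + 6 * encode w) / 6 = encode w by omega, ih]

/-- The codes of the factors of length nine of `Z`. -/
def nineCodes : List ℕ :=
  [105057, 105323, 105463, 105828, 105842, 106204, 450599, 630344, 631942, 632781, 634973,
    635053, 637224, 1105420, 1122662, 1122669, 1122673, 1122683, 1122684, 1122694, 1591501,
    2537001, 2594520, 2594521, 2594522, 2594523, 2594524, 2594525, 2624747, 2703469, 2703513,
    2703537, 2703598, 2703600, 2703660, 2706534, 2784674, 3782065, 3791652, 3796689, 3809842,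
    3810321, 3823344, 5144311, 5489426, 5489433, 5489437, 5489447, 5489448, 5489458, 5670790,
    6143121, 6143387, 6143527, 6143892, 6143906, 6144268, 6161510, 6625640, 6627238, 6628077,
    6630269, 6630349, 6632520, 6735973, 6736017, 6736041, 6736102, 6736104, 6736164, 6793563,
    6823787, 6902700, 6905574, 6905575, 6905576, 6905577, 6905578, 6905579, 6983714, 9520753,
    9530340, 9535377, 9548530, 9549009, 9562032]

/-- The factors of length nine of `Z`. -/
def nineFactors : List (List Letter) := nineCodes.map (decode 9)

/-- A window of nine letters starts at offset `0` or `1` of the image of another such window; ten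
letters in the image leave room for both offsets. -/
theorem nineCodes_closed : ∀ c ∈ nineCodes,
    encode ((substWord (decode 9 c)).take 9) ∈ nineCodes ∧
      encode (((substWord (decode 9 c)).drop 1).take 9) ∈ nineCodes ∧
      10 ≤ (substWord (decode 9 c)).length := by
  decide +kernel

theorem mem_nineFactors {w : List Letter} (hw : w.length = 9) (h : encode w ∈ nineCodes) :
    w ∈ nineFactors :=
  List.mem_map.2 ⟨_, h, by rw [← hw, decode_encode]⟩

theorem nineFactors_closed : ∀ w ∈ nineFactors,
    (substWord w).take 9 ∈ nineFactors ∧ ((substWord w).drop 1).take 9 ∈ nineFactors ∧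
      10 ≤ (substWord w).length := by
  intro w hw
  obtain ⟨c, hc, rfl⟩ := List.mem_map.1 hw
  obtain ⟨h₁, h₂, h₃⟩ := nineCodes_closed c hc
  refine ⟨mem_nineFactors ?_ h₁, mem_nineFactors ?_ h₂, h₃⟩ <;>
  · simp only [List.length_take, List.length_drop]
    omega

theorem block_add (i m n : ℕ) : block Z i (m + n) = block Z i m ++ block Z (i + m) n := by
  simp [block, List.range_add, Nat.add_assoc]

theorem substWord_block (j n : ℕ) :
    substWord (block Z j n) = block Z (cut j) (cut (j + n) - cut j) := by
  induction n with
  | zero => simp [block, substWord]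
  | succ n ih =>
    have h₁ := cut_add_bounds j n
    have h₂ := cut_succ_bounds (j + n)
    rw [block_add, substWord_append, ih, show j + (n + 1) = j + n + 1 by omega,
      show cut (j + n + 1) - cut j = (cut (j + n) - cut j) + (cut (j + n + 1) - cut (j + n)) by
        omega, block_add, show cut j + (cut (j + n) - cut j) = cut (j + n) by omega]
    congr 1
    apply List.ext_getElem
    · simp [block, substWord, cut]
    · intro o h₃ h₄
      simp [block, substWord] at h₃ ⊢
      rw [Z_cut_add]

theorem block_drop_take {i n m o : ℕ} (h : o + m ≤ n) :
    ((block Z i n).drop o).take m = block Z (i + o) m := by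
  apply List.ext_getElem
  · simp [block]; omega
  · intro k h₁ h₂
    simp [block, Nat.add_assoc]

theorem block_mem_nineFactors (i : ℕ) : block Z i 9 ∈ nineFactors := by
  induction i using Nat.strong_induction_on with
  | _ i ih =>
    -- The descent needs `j < cut j`, which fails only for `j = 0`; the image of that letter
    -- occupies positions `0` and `1`.
    by_cases hi : i < 2
    · refine mem_nineFactors (by simp [block]) ?_
      interval_cases i <;> decide +kernel
    · have hc : ∀ j, 1 ≤ j → j < cut j := by
        intro j hj
        have h := cut_add_bounds 1 (j - 1)
        have h1 : cut 1 = 2 := by decide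
        rw [show 1 + (j - 1) = j by omega] at h
        omega
      obtain ⟨j, hj⟩ := exists_eq_cut i
      have hj1 : 1 ≤ j := by
        by_contra h0
        obtain rfl : j = 0 := by omega
        have : cut 0 = 0 := rfl
        omega
      have hlt := hc j hj1
      have hj9 := nineFactors_closed _ (ih j (by omega))
      rw [substWord_block] at hj9
      obtain ⟨h₁, h₂, h₃⟩ := hj9
      have h₄ : 10 ≤ cut (j + 9) - cut j := by simpa [block] using h₃
      rw [block_drop_take (by omega)] at h₂
      have h₅ := block_drop_take (i := cut j) (n := cut (j + 9) - cut j) (m := 9) (o := 0)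
        (by omega)
      rw [List.drop_zero, Nat.add_zero] at h₅
      rw [h₅] at h₁
      rcases hj with rfl | ⟨rfl, _⟩
      · exact h₁
      · exact h₂

/-! ### Local properties of `Z` and `ja`, read off from windows -/

/-- The letter number `k` of a window. -/
def letterAt (w : List Letter) (k : ℕ) : Letter := w.getD k (0, 0)

theorem letterAt_block {i k : ℕ} (hk : k < 9) : letterAt (block Z i 9) k = Z (i + k) := by
  have h : k < (block Z i 9).length := by simpa [block] using hk
  rw [letterAt, List.getD_eq_getElem _ _ h]
  simp [block]

theorem window_facts : ∀ w ∈ nineFactors,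
    ((letterAt w 0).2 = 2 → (letterAt w 1).2 = 0) ∧
    ((letterAt w 0).2 = 0 ∨ (letterAt w 1).2 = 0 ∨ (letterAt w 2).2 = 0) ∧
    ((letterAt w 1).2 = 2 → letterAt w 0 = ((letterAt w 1).1, 1)) ∧
    (¬ ∀ k < 4, (letterAt w k).1 = (letterAt w (1 + k)).1) ∧
    (¬ ∀ k < 5, (letterAt w k).1 = (letterAt w (2 + k)).1) := by
  decide +kernel

/-- This and `window_clash_four` are the base cases of `exists_clash`. Period `4` reaches offset
`8`, hence windows of nine letters. -/
theorem window_clash_three : ∀ w ∈ nineFactors, (∀ k < 2, letterAt w k = letterAt w (3 + k)) →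
    ((letterAt w 2).2 = 0 ∧ (letterAt w 5).2 = 0 ∧ (letterAt w 2).1 ≠ (letterAt w 5).1) ∨
    (letterAt w 2 = letterAt w 5 ∧
      (letterAt w 3).2 = 0 ∧ (letterAt w 6).2 = 0 ∧ (letterAt w 3).1 ≠ (letterAt w 6).1) := by
  decide +kernel

theorem window_clash_four : ∀ w ∈ nineFactors, (∀ k < 3, letterAt w k = letterAt w (4 + k)) →
    ((letterAt w 3).2 = 0 ∧ (letterAt w 7).2 = 0 ∧ (letterAt w 3).1 ≠ (letterAt w 7).1) ∨
    (letterAt w 3 = letterAt w 7 ∧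
      (letterAt w 4).2 = 0 ∧ (letterAt w 8).2 = 0 ∧ (letterAt w 4).1 ≠ (letterAt w 8).1) := by
  decide +kernel

theorem window_determined : ∀ v ∈ nineFactors, ∀ w ∈ nineFactors,
    (∀ k < 5, (letterAt v k).1 = (letterAt w k).1) → letterAt v 2 = letterAt w 2 := by
  decide +kernel

theorem type_succ_of_type_two {i : ℕ} (h : (Z i).2 = 2) : (Z (i + 1)).2 = 0 := by
  have key := (window_facts _ (block_mem_nineFactors i)).1
  rw [letterAt_block (by omega), letterAt_block (by omega)] at key
  exact key h

/-- One of three consecutive letters has type `0`. This makes the period strictly decrease under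
desubstitution. -/
theorem cut_add_three (i : ℕ) : cut i + 4 ≤ cut (i + 3) := by
  have key := (window_facts _ (block_mem_nineFactors i)).2.1
  rw [letterAt_block (by omega), letterAt_block (by omega), letterAt_block (by omega)] at key
  have h₀ : _ ≤ cut (i + 1) ∧ _ := cut_succ_bounds i
  have h₁ : _ ≤ cut (i + 2) ∧ _ := cut_succ_bounds (i + 1)
  have h₂ : _ ≤ cut (i + 3) ∧ _ := cut_succ_bounds (i + 2)
  rcases key with h | h | h
  · have : cut (i + 1) = _ := cut_succ_of_type_zero h
    omega
  · have : cut (i + 2) = _ := cut_succ_of_type_zero h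
    omega
  · have : cut (i + 3) = _ := cut_succ_of_type_zero h
    omega

theorem Z_of_succ_type_two {i : ℕ} (h : (Z (i + 1)).2 = 2) : Z i = ((Z (i + 1)).1, 1) := by
  have key := (window_facts _ (block_mem_nineFactors i)).2.2.1
  rw [letterAt_block (by omega), letterAt_block (by omega)] at key
  exact key h

theorem Z_eq_of_ja_window {i j : ℕ} (h : ∀ k < 5, ja (i + k) = ja (j + k)) :
    Z (i + 2) = Z (j + 2) := by
  have key := window_determined _ (block_mem_nineFactors i) _ (block_mem_nineFactors j)
    fun k hk => by
      rw [letterAt_block (by omega), letterAt_block (by omega), fst_Z, fst_Z, h k hk]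
  rwa [letterAt_block (by omega), letterAt_block (by omega)] at key

theorem not_ja_period_one (i : ℕ) : ¬ ∀ k < 4, ja (i + k) = ja (i + 1 + k) := by
  intro h
  refine (window_facts _ (block_mem_nineFactors i)).2.2.2.1 fun k hk => ?_
  rw [letterAt_block (by omega), letterAt_block (by omega), fst_Z, fst_Z, h k hk, Nat.add_assoc]

theorem not_ja_period_two (i : ℕ) : ¬ ∀ k < 5, ja (i + k) = ja (i + 2 + k) := by
  intro h
  refine (window_facts _ (block_mem_nineFactors i)).2.2.2.2 fun k hk => ?_
  rw [letterAt_block (by omega), letterAt_block (by omega), fst_Z, fst_Z, h k hk, Nat.add_assoc]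

/-! ### Squares of the fixed point -/

/-- The factors of length `n` of `Z` at the positions `i` and `j` coincide. -/
def Agree (i j n : ℕ) : Prop := ∀ k < n, Z (i + k) = Z (j + k)

/-- `Z` carries letters of type `0` with different signs at `i` and `j`. -/
def Clash (i j : ℕ) : Prop := (Z i).2 = 0 ∧ (Z j).2 = 0 ∧ (Z i).1 ≠ (Z j).1

theorem Agree.mono {i j m n : ℕ} (h : Agree i j n) (hm : m ≤ n) : Agree i j m :=
  fun k hk => h k (hk.trans_le hm)

theorem Agree.cut_add {i j n : ℕ} (h : Agree i j n) :
    cut (i + n) + cut j = cut (j + n) + cut i := by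
  induction n with
  | zero => simp [Nat.add_comm]
  | succ n ih =>
    have h₁ := ih (h.mono n.le_succ)
    have h₂ := h n n.lt_succ_self
    rw [← Nat.add_assoc, ← Nat.add_assoc, cut, cut, h₂]
    omega

theorem Agree.image {i j n : ℕ} (h : Agree i j n) :
    Agree (cut i) (cut j) (cut (i + n) - cut i) := by
  have hb : block Z i n = block Z j n := by
    apply List.ext_getElem
    · simp [block]
    · intro k h₁ h₂
      simp only [block, List.length_map, List.length_range] at h₁
      simpa [block] using h k h₁
  have hc := h.cut_add
  have hw := congrArg substWord hb
  rw [substWord_block, substWord_block,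
    show cut (j + n) - cut j = cut (i + n) - cut i by omega] at hw
  intro k hk
  have := List.ext_getElem_iff.1 hw |>.2 k (by simpa [block] using hk) (by simpa [block] using hk)
  simpa [block] using this

theorem eq_or_of_firstLetter_eq {x y : Letter} (h : firstLetter x = firstLetter y) :
    x = y ∨ (x.2 = 0 ∧ y.2 = 2) ∨ (x.2 = 2 ∧ y.2 = 0) := by
  revert x y; decide

/-- Desubstitution of a square that lacks at most its last letter. -/
theorem Agree.desubst {j q p : ℕ} (hq : cut (j + q) = cut j + p)
    (h : Agree (cut j) (cut (j + q)) (p - 1)) : Agree j (j + q) (q - 1) := by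
  suffices ∀ n ≤ q - 1, Agree j (j + q) n from this _ le_rfl
  intro n
  induction n with
  | zero => intro _ k hk; omega
  | succ n ih =>
    intro hn
    have ih := ih (by omega)
    have hc := ih.cut_add
    have hb₁ := cut_add_bounds j n
    have hb₂ := cut_add_bounds (j + q) n
    have hb₃ := cut_add_bounds (j + n + 1) (q - 1 - (n + 1))
    rw [show j + n + 1 + (q - 1 - (n + 1)) = j + (q - 1) by omega] at hb₃
    have hb₄ := cut_succ_bounds (j + (q - 1))
    rw [show j + (q - 1) + 1 = j + q by omega] at hb₄
    have hb₅ := cut_succ_bounds (j + n)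
    have hfirst := h (cut (j + n) - cut j) (by omega)
    rw [show cut j + (cut (j + n) - cut j) = cut (j + n) by omega,
      show cut (j + q) + (cut (j + n) - cut j) = cut (j + q + n) by omega, Z_cut, Z_cut] at hfirst
    have hsecond := h (cut (j + n) + 1 - cut j)
    rw [show cut j + (cut (j + n) + 1 - cut j) = cut (j + n) + 1 by omega,
      show cut (j + q) + (cut (j + n) + 1 - cut j) = cut (j + q + n) + 1 by omega] at hsecond
    have hn : Z (j + n) = Z (j + q + n) := by
      rcases eq_or_of_firstLetter_eq hfirst with e | ⟨e₁, e₂⟩ | ⟨e₁, e₂⟩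
      · exact e
      -- The image of one letter continues with a letter of type `1`, while at the other position a
      -- new image starts.
      · have c₁ := cut_succ_of_type_zero e₁
        have c₂ := cut_succ_of_type_ne_zero (k := j + q + n) (by rw [e₂]; decide)
        have hs := hsecond (by omega)
        rw [Z_cut_add_one e₁, ← c₂] at hs
        exact absurd (congrArg Prod.snd hs).symm (type_Z_cut_ne_one _)
      -- The letter to compare might be the missing last one of the square; the type `0` letter that
      -- follows a type `2` letter has an image of length two and rules this out.
      · have c₁ := cut_succ_of_type_ne_zero (k := j + n) (by rw [e₁]; decide)
        have e₃ := type_succ_of_type_two e₁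
        have c₃ := cut_succ_of_type_zero e₃
        have hb₆ := cut_strictMono.monotone (show j + n + 1 + 1 ≤ j + q by omega)
        have hs := hsecond (by omega)
        rw [Z_cut_add_one e₂, ← c₁] at hs
        exact absurd (congrArg Prod.snd hs) (type_Z_cut_ne_one _)
    intro k hk
    rcases Nat.lt_succ_iff_lt_or_eq.1 hk with hk | rfl
    · exact ih k hk
    · exact hn

theorem exists_clash_three {i : ℕ} (h : Agree i (i + 3) 2) :
    ∃ n, 2 ≤ n ∧ n ≤ 3 ∧ Agree i (i + 3) n ∧ Clash (i + n) (i + 3 + n) := by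
  have key := window_clash_three _ (block_mem_nineFactors i) fun k hk => by
    rw [letterAt_block (by omega), letterAt_block (by omega), h k hk, Nat.add_assoc]
  repeat rw [letterAt_block (by omega)] at key
  rcases key with key | ⟨key, hcl⟩
  · exact ⟨2, le_rfl, by omega, h, key⟩
  · refine ⟨3, by omega, le_rfl, fun k hk => ?_, hcl⟩
    rcases Nat.lt_succ_iff_lt_or_eq.1 hk with hk | rfl
    · exact h k hk
    · exact key

theorem exists_clash_four {i : ℕ} (h : Agree i (i + 4) 3) :
    ∃ n, 3 ≤ n ∧ n ≤ 4 ∧ Agree i (i + 4) n ∧ Clash (i + n) (i + 4 + n) := by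
  have key := window_clash_four _ (block_mem_nineFactors i) fun k hk => by
    rw [letterAt_block (by omega), letterAt_block (by omega), h k hk, Nat.add_assoc]
  repeat rw [letterAt_block (by omega)] at key
  rcases key with key | ⟨key, hcl⟩
  · exact ⟨3, le_rfl, by omega, h, key⟩
  · refine ⟨4, by omega, le_rfl, fun k hk => ?_, hcl⟩
    rcases Nat.lt_succ_iff_lt_or_eq.1 hk with hk | rfl
    · exact h k hk
    · exact key

theorem Clash.ne {i j : ℕ} (h : Clash i j) : Z i ≠ Z j := fun e => h.2.2 (by rw [e])

theorem Clash.image {i j : ℕ} (h : Clash i j) : Clash (cut i) (cut j) := by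
  unfold Clash
  rw [Z_cut, Z_cut]
  obtain ⟨h₁, h₂, h₃⟩ := h
  simp [firstLetter, h₁, h₂, h₃]

/-- A square of `Z` of period at least `3` that lacks at most its last letter stops at a clash. -/
theorem exists_clash (p : ℕ) (hp : 3 ≤ p) : ∀ i, Agree i (i + p) (p - 1) →
    ∃ n, p - 1 ≤ n ∧ n ≤ p ∧ Agree i (i + p) n ∧ Clash (i + n) (i + p + n) := by
  induction p using Nat.strong_induction_on with
  | _ p ih =>
    -- Squares that start at a cut. Periods `3` and `4` are separate since they could desubstitute
    -- to period `2`; from `p ≥ 5` and `p ≤ 2q` it follows that `q ≥ 3`.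
    have hcut : ∀ j, Agree (cut j) (cut j + p) (p - 1) →
        ∃ n, p - 1 ≤ n ∧ n ≤ p ∧ Agree (cut j) (cut j + p) n ∧
          Clash (cut j + n) (cut j + p + n) := by
      intro j h
      by_cases h3 : p = 3
      · subst h3; exact exists_clash_three h
      by_cases h4 : p = 4
      · subst h4; exact exists_clash_four h
      have h₀ := h 0 (by omega)
      rw [Nat.add_zero, Nat.add_zero] at h₀
      obtain ⟨j', hj'⟩ := exists_eq_cut_of_type_ne_one (i := cut j + p)
        (by rw [← h₀]; exact type_Z_cut_ne_one j)
      have hjj : j ≤ j' := cut_strictMono.le_iff_le.1 (by omega)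
      obtain ⟨q, rfl⟩ := Nat.exists_eq_add_of_le hjj
      have hb := cut_add_bounds j q
      rw [hj'] at h ⊢
      have hd := h.desubst hj'.symm
      have hqp : q < p := by
        have h₁ := cut_add_three j
        have h₂ := cut_add_bounds (j + 3) (q - 3)
        rw [show j + 3 + (q - 3) = j + q by omega] at h₂
        omega
      obtain ⟨n, hn₁, hn₂, ha, hcl⟩ := ih q hqp (by omega) j hd
      have hi := ha.image
      have hcl' := hcl.image
      have hc := ha.cut_add
      have hb₁ := cut_add_bounds j n
      have hmono := cut_strictMono.monotone (show j + n ≤ j + q by omega)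
      rw [show cut (j + n) = cut j + (cut (j + n) - cut j) by omega,
        show cut (j + q + n) = cut (j + q) + (cut (j + n) - cut j) by omega] at hcl'
      refine ⟨_, ?_, by omega, hi, hcl'⟩
      -- A clash before offset `p - 1` would contradict the given agreement.
      by_contra hlt
      exact hcl'.ne (h _ (by omega))
    intro i h
    obtain ⟨j, rfl | ⟨rfl, hj⟩⟩ := exists_eq_cut i
    · exact hcut j h
    · have h₀ := h 0 (by omega)
      rw [Nat.add_zero, Nat.add_zero, Z_cut_add_one hj] at h₀
      obtain ⟨j', hj' | ⟨hj', ht⟩⟩ := exists_eq_cut (cut j + 1 + p)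
      · rw [hj'] at h₀
        exact absurd (congrArg Prod.snd h₀).symm (type_Z_cut_ne_one _)
      -- A letter of type `1` determines its predecessor in the image, so the square extends one
      -- letter to the left and then starts at a cut.
      have h' : Agree (cut j) (cut j + p) p := by
        intro k hk
        rcases k with _ | k
        · rw [hj', Z_cut_add_one ht] at h₀
          rw [Nat.add_zero, Nat.add_zero, show cut j + p = cut j' by omega, Z_cut, Z_cut]
          have e := congrArg Prod.fst h₀
          revert e hj ht
          generalize Z j = x
          generalize Z j' = y
          revert x y; decide
        · have := h k (by omega)
          rwa [show cut j + (k + 1) = cut j + 1 + k by omega,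
            show cut j + p + (k + 1) = cut j + 1 + p + k by omega]
      obtain ⟨n, hn₁, hn₂, ha, hcl⟩ := hcut j (h'.mono (by omega))
      obtain rfl : n = p := by
        by_contra hne
        exact hcl.ne (h' n (by omega))
      refine ⟨n - 1, le_rfl, by omega, h, ?_⟩
      rwa [show cut j + 1 + (n - 1) = cut j + n by omega,
        show cut j + 1 + n + (n - 1) = cut j + n + n by omega]

/-- The bound on repetitions in `ja`. -/
theorem not_ja_long_repetition (i p : ℕ) (hp : 1 ≤ p) :
    ¬ ∀ k < p + 3, ja (i + k) = ja (i + p + k) := by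
  intro h
  by_cases h1 : p = 1
  · subst h1; exact not_ja_period_one i fun k hk => h k (by omega)
  by_cases h2 : p = 2
  · subst h2; exact not_ja_period_two i fun k hk => h k (by omega)
  -- Passing to middle letters of five-letter windows costs two letters at each end: `p + 3 - 4 = p
  -- - 1`. The clash then lies at offset `n + 2 ≤ p + 2` of the repetition in `ja`.
  have hA : Agree (i + 2) (i + 2 + p) (p - 1) := by
    intro k hk
    have := Z_eq_of_ja_window (i := i + k) (j := i + p + k) fun m hm => by
      have := h (k + m) (by omega)
      rwa [← Nat.add_assoc, ← Nat.add_assoc] at this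
    rwa [show i + 2 + k = i + k + 2 by omega, show i + 2 + p + k = i + p + k + 2 by omega]
  obtain ⟨n, hn₁, hn₂, -, hcl⟩ := exists_clash p (by omega) (i + 2) hA
  apply hcl.2.2
  rw [fst_Z, fst_Z]
  have := h (n + 2) (by omega)
  rwa [show i + (n + 2) = i + 2 + n by omega,
    show i + p + (n + 2) = i + 2 + p + n by omega] at this

/-! ### Long squares -/

/-- A square of `Z` of period `p` that starts at `m + 1`. -/
def SquareAfter (m p : ℕ) : Prop := Agree (m + 1) (m + 1 + p) p

theorem SquareAfter.image {m p : ℕ} (h : SquareAfter m p) :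
    ∃ m' p', m' + 1 = cut (m + 1) ∧ m' + 1 + p' = cut (m + p + 1) ∧ p ≤ p' ∧
      SquareAfter m' p' ∧ Z m' = lastLetter (Z m) ∧ Z (m' + p') = lastLetter (Z (m + p)) := by
  have h₁ := (cut_succ_bounds m).1
  have h₂ := (cut_add_bounds (m + 1) p).1
  have h₃ := Agree.image h
  rw [show m + 1 + p = m + p + 1 by omega] at h₂ h₃
  refine ⟨cut (m + 1) - 1, cut (m + p + 1) - cut (m + 1), by omega, by omega, by omega, ?_,
    Z_cut_succ_sub_one m, ?_⟩
  · unfold SquareAfter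
    rwa [show cut (m + 1) - 1 + 1 = cut (m + 1) by omega,
      show cut (m + 1) + (cut (m + p + 1) - cut (m + 1)) = cut (m + p + 1) by omega]
  · rw [show cut (m + 1) - 1 + (cut (m + p + 1) - cut (m + 1)) = cut (m + p + 1) - 1 by omega,
      Z_cut_succ_sub_one]

theorem lastLetter_two (s : Fin 2) : lastLetter (s, 2) = (s, 0) := rfl

theorem lastLetter_zero (s : Fin 2) : lastLetter (s, 0) = (1 - s, 1) := rfl

theorem lastLetter_one (s : Fin 2) : lastLetter (s, 1) = (s, 2) := rfl

/-- Under `lastLetter`, `(s, 2)` runs through `(s, 0)`, `(1 - s, 1)`, `(1 - s, 2)` and `(s, 0)`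
through `(1 - s, 1)`, `(1 - s, 2)`, `(1 - s, 0)`: after three steps the pair before the square
recurs with the sign flipped. -/
theorem exists_square (n : ℕ) : ∃ m p s, n < p ∧ SquareAfter m p ∧ Z m = (s, 2) ∧
    Z (m + p) = (s, 0) ∧ Z (m + p - 1) = (s, 2) := by
  induction n with
  | zero =>
    refine ⟨8, 4, 0, by omega, ?_, by decide +kernel, by decide +kernel, by decide +kernel⟩
    unfold SquareAfter Agree
    decide +kernel
  | succ n ih =>
    obtain ⟨m, p, s, hp, hsq, hm, hmp, -⟩ := ih
    obtain ⟨m₁, p₁, hm₁, hp₁, -, hsq₁, z₁, z₁'⟩ := hsq.image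
    obtain ⟨m₂, p₂, hm₂, hp₂, hle₂, hsq₂, z₂, z₂'⟩ := hsq₁.image
    obtain ⟨m₃, p₃, hm₃, hp₃, hle₃, hsq₃, z₃, z₃'⟩ := hsq₂.image
    rw [hm, lastLetter_two] at z₁
    rw [hmp, lastLetter_zero] at z₁'
    rw [z₁, lastLetter_zero] at z₂
    rw [z₁', lastLetter_one] at z₂'
    rw [z₂, lastLetter_one] at z₃
    rw [z₂', lastLetter_two] at z₃'
    -- The letter of type `0` that ends the first period has an image of length two.
    have hlt : p < p₁ := by
      have h₁ := cut_succ_of_type_zero (k := m + p) (by rw [hmp])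
      have h₂ := (cut_add_bounds (m + 1) (p - 1)).1
      rw [show m + 1 + (p - 1) = m + p by omega] at h₂
      omega
    refine ⟨m₃, p₃, 1 - s, by omega, hsq₃, z₃, z₃', ?_⟩
    -- The letter at `m₂ + p₂` has type `2` and a one-letter image, so the position before `m₃ + p₃`
    -- ends the image of the preceding letter `(1 - s, 1)`.
    have ht := cut_succ_of_type_ne_zero (k := m₂ + p₂) (by rw [z₂']; simp)
    obtain ⟨q, hq⟩ : ∃ q, m₂ + p₂ = q + 1 := ⟨m₂ + p₂ - 1, by omega⟩
    have hZq := Z_of_succ_type_two (i := q) (by rw [← hq, z₂'])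
    rw [← hq, z₂'] at hZq
    rw [show m₃ + p₃ - 1 = cut (q + 1) - 1 by rw [← hq]; omega, Z_cut_succ_sub_one, hZq,
      lastLetter_one]

theorem exists_ja_repetition (n : ℕ) : ∃ i p, n < p ∧ ∀ k < p + 2, ja (i + k) = ja (i + p + k) := by
  obtain ⟨m, p, s, hp, hsq, hm, hmp, hmp'⟩ := exists_square n
  obtain ⟨i, rfl⟩ : ∃ i, m = i + 1 := by
    refine ⟨m - 1, ?_⟩
    by_contra h
    obtain rfl : m = 0 := by omega
    exact absurd (congrArg Prod.snd hm) (by decide +kernel : ¬ (Z 0).2 = 2)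
  have hi := Z_of_succ_type_two (i := i) (by rw [hm])
  rw [hm] at hi
  refine ⟨i, p, hp, fun k hk => ?_⟩
  rw [← fst_Z, ← fst_Z]
  match k with
  | 0 =>
    rw [show i + 1 + p - 1 = i + p by omega] at hmp'
    rw [Nat.add_zero, Nat.add_zero, hi, hmp']
  | 1 => rw [hm, show i + p + 1 = i + 1 + p by omega, hmp]
  | k + 2 =>
    have := hsq k (by omega)
    rw [show i + (k + 2) = i + 1 + 1 + k by omega, this,
      show i + p + (k + 2) = i + 1 + 1 + p + k by omega]

/-! ### Narayana representations and the letters of `ja` -/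

theorem length_X_add_three (k : ℕ) :
    (X (k + 3)).length = (X (k + 2)).length + (X k).length := by
  rw [X, List.length_append, complement, List.length_map]

theorem length_X (k : ℕ) : (X (k + 2)).length = narayana k := by
  induction k using Nat.strong_induction_on with
  | _ k ih =>
    match k with
    | 0 => decide
    | 1 => decide
    | 2 => decide
    | k + 3 =>
      rw [length_X_add_three, ih (k + 2) (by omega), ih k (by omega), narayana]

theorem narayana_succ (k : ℕ) : narayana (k + 1) = narayana k + (X k).length := by
  rw [← length_X, ← length_X, length_X_add_three]

theorem narayana_mono : Monotone narayana :=
  monotone_nat_of_le_succ fun k => by rw [narayana_succ]; omega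

theorem getElem_X {k n : ℕ} (h : n < (X k).length) : (X k)[n] = ja n := by
  have := List.getElem_of_eq (X_isPrefix k) h
  rw [this]
  simp [block]

theorem ja_narayana_add {k r : ℕ} (h : r < (X k).length) : ja (narayana k + r) = 1 - ja r := by
  have h₁ : narayana k + r < (X (k + 3)).length := by
    rw [length_X_add_three, length_X]; omega
  rw [← getElem_X h₁]
  have h₂ : X (k + 3) = X (k + 2) ++ complement (X k) := by rw [X]
  simp only [h₂]
  rw [List.getElem_append_right (by rw [length_X]; omega)]
  simp [complement, length_X, getElem_X]

/-- Neither `11` nor `101` occurs in `e`. -/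
def Admissible (e : List (Fin 2)) : Prop := ¬ [1, 1] <:+: e ∧ ¬ [1, 0, 1] <:+: e

theorem admissible_nil : Admissible [] := by
  constructor <;> simp

theorem admissible_cons_zero {e : List (Fin 2)} : Admissible (0 :: e) ↔ Admissible e := by
  simp [Admissible, List.infix_cons_iff, List.cons_prefix_cons]

theorem admissible_cons_one {e : List (Fin 2)} :
    Admissible (1 :: e) ↔ Admissible e ∧ ¬ [1] <+: e ∧ ¬ [0, 1] <+: e := by
  simp only [Admissible, List.infix_cons_iff, List.cons_prefix_cons, true_and]
  tauto

theorem fin_two_eq (d : Fin 2) : d = 0 ∨ d = 1 := by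
  revert d; decide

theorem narayanaValue_cons_zero (e : List (Fin 2)) :
    narayanaValue (0 :: e) = narayanaValue e := by
  simp [narayanaValue]

theorem narayanaValue_cons_one (e : List (Fin 2)) :
    narayanaValue (1 :: e) = narayana e.length + narayanaValue e := by
  simp [narayanaValue]

/-- After a `1` come two zeros, unless the string ends first. Dropping them gives the sharper bound;
the length of `X` also covers tails of fewer than two digits. -/
theorem narayanaValue_bounds (e : List (Fin 2)) (h : Admissible e) :
    narayanaValue e < narayana e.length ∧
      (Admissible (1 :: e) → narayanaValue e < (X e.length).length) := by
  induction hn : e.length using Nat.strong_induction_on generalizing e with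
  | _ n ih =>
    subst hn
    have tail : Admissible (1 :: e) → narayanaValue e < (X e.length).length := by
      intro h₁
      obtain ⟨-, h₂, h₃⟩ := admissible_cons_one.1 h₁
      match e with
      | [] => decide
      | d :: e =>
        obtain rfl | rfl := fin_two_eq d
        · match e with
          | [] => decide
          | d :: e =>
            obtain rfl | rfl := fin_two_eq d
            · rw [admissible_cons_zero, admissible_cons_zero] at h
              rw [narayanaValue_cons_zero, narayanaValue_cons_zero]
              exact (length_X e.length).symm ▸ (ih e.length (by simp) e h rfl).1
            · exact absurd (by simp [List.cons_prefix_cons]) h₃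
        · exact absurd (by simp [List.cons_prefix_cons]) h₂
    refine ⟨?_, tail⟩
    match e with
    | [] => decide
    | d :: e =>
      rw [List.length_cons, narayana_succ]
      obtain rfl | rfl := fin_two_eq d
      · rw [narayanaValue_cons_zero]
        have := (ih e.length (by simp) e (admissible_cons_zero.1 h) rfl).1
        omega
      · rw [narayanaValue_cons_one]
        have := (ih e.length (by simp) e (admissible_cons_one.1 h).1 rfl).2 h
        omega

theorem eq_of_narayanaValue_eq {e f : List (Fin 2)} (he : Admissible e) (hf : Admissible f)
    (hl : e.length = f.length) (hv : narayanaValue e = narayanaValue f) : e = f := by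
  induction e generalizing f with
  | nil => exact (List.eq_nil_of_length_eq_zero hl.symm).symm
  | cons d e ih =>
    match f with
    | c :: f =>
      have hl' : e.length = f.length := by simpa using hl
      obtain rfl | rfl := fin_two_eq d <;> obtain rfl | rfl := fin_two_eq c
      · rw [admissible_cons_zero] at he hf
        rw [narayanaValue_cons_zero, narayanaValue_cons_zero] at hv
        rw [ih he hf hl' hv]
      · rw [admissible_cons_zero] at he
        rw [narayanaValue_cons_zero, narayanaValue_cons_one] at hv
        have := (narayanaValue_bounds e he).1
        rw [hl'] at this
        omega
      · rw [admissible_cons_zero] at hf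
        rw [narayanaValue_cons_zero, narayanaValue_cons_one] at hv
        have := (narayanaValue_bounds f hf).1
        rw [← hl'] at this
        omega
      · rw [narayanaValue_cons_one, narayanaValue_cons_one, hl'] at hv
        rw [ih (admissible_cons_one.1 he).1 (admissible_cons_one.1 hf).1 hl' (by omega)]

theorem length_le_of_narayanaValue_le {e f : List (Fin 2)} (he : Admissible e)
    (hh : f.head? ≠ some 0) (hv : narayanaValue f ≤ narayanaValue e) : f.length ≤ e.length := by
  match f with
  | [] => simp
  | d :: f =>
    obtain rfl | rfl := fin_two_eq d
    · exact absurd rfl hh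
    · rw [narayanaValue_cons_one] at hv
      have h₁ := (narayanaValue_bounds e he).1
      by_contra hlt
      have h₂ := narayana_mono (show e.length ≤ f.length by simp at hlt; omega)
      omega

/-- Greedy expansion, padded with leading zeros to length `k`; a digit `1` is followed by `00` as
far as the length allows. -/
theorem exists_admissible (k : ℕ) : ∀ m < narayana k,
    ∃ e : List (Fin 2), e.length = k ∧ Admissible e ∧ narayanaValue e = m := by
  induction k using Nat.strong_induction_on with
  | _ k ih =>
    intro m hm
    match k with
    | 0 =>
      have : m = 0 := by simpa [narayana] using hm
      exact ⟨[], rfl, admissible_nil, this.symm⟩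
    | k + 1 =>
      by_cases h : m < narayana k
      · obtain ⟨e, hl, ha, hv⟩ := ih k (by omega) m h
        exact ⟨0 :: e, by simp [hl], admissible_cons_zero.2 ha, by
          rw [narayanaValue_cons_zero, hv]⟩
      · rw [narayana_succ] at hm
        match k with
        | 0 =>
          have h₁ : (X 0).length = 1 := rfl
          refine ⟨[1], rfl, admissible_cons_one.2 ⟨admissible_nil, by simp, by simp⟩, ?_⟩
          rw [narayanaValue_cons_one, narayanaValue, List.length_nil]
          omega
        | 1 =>
          have h₁ : (X 1).length = 1 := rfl
          refine ⟨[1, 0], rfl, admissible_cons_one.2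
            ⟨admissible_cons_zero.2 admissible_nil, by simp, by simp⟩, ?_⟩
          rw [narayanaValue_cons_one, narayanaValue_cons_zero, narayanaValue, List.length_cons,
            List.length_nil, Nat.zero_add]
          omega
        | k + 2 =>
          rw [length_X] at hm
          obtain ⟨e, hl, ha, hv⟩ := ih k (by omega) (m - narayana (k + 2)) (by omega)
          refine ⟨1 :: 0 :: 0 :: e, by simp [hl], admissible_cons_one.2
            ⟨admissible_cons_zero.2 (admissible_cons_zero.2 ha), by simp, by simp⟩, ?_⟩
          rw [narayanaValue_cons_one, narayanaValue_cons_zero, narayanaValue_cons_zero, hv,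
            List.length_cons, List.length_cons, hl, show k + 1 + 1 = k + 2 from rfl]
          omega

theorem exists_isNarayanaRep_of_admissible (e : List (Fin 2)) (h : Admissible e) :
    ∃ f, IsNarayanaRep f (narayanaValue e) := by
  induction e with
  | nil => exact ⟨[], rfl, by simp, admissible_nil⟩
  | cons d e ih =>
    obtain rfl | rfl := fin_two_eq d
    · rw [narayanaValue_cons_zero]
      exact ih (admissible_cons_zero.1 h)
    · exact ⟨1 :: e, rfl, by simp, h⟩

theorem existsUnique_isNarayanaRep (m : ℕ) : ∃! e, IsNarayanaRep e m := by
  have hm : m < narayana m := by rw [← length_X]; exact lt_length_X m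
  obtain ⟨e, -, ha, rfl⟩ := exists_admissible m m hm
  obtain ⟨f, hf⟩ := exists_isNarayanaRep_of_admissible e ha
  refine ⟨f, hf, fun g hg => ?_⟩
  obtain ⟨hv, hh, hfa⟩ := hf
  obtain ⟨hv', hh', hga⟩ := hg
  exact eq_of_narayanaValue_eq hga hfa
    (le_antisymm (length_le_of_narayanaValue_le hfa hh' (by omega))
      (length_le_of_narayanaValue_le hga hh (by omega))) (by omega)

theorem ja_narayanaValue (e : List (Fin 2)) (h : Admissible e) :
    (ja (narayanaValue e) : ℕ) = e.count 1 % 2 := by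
  induction e with
  | nil => decide
  | cons d e ih =>
    obtain rfl | rfl := fin_two_eq d
    · rw [narayanaValue_cons_zero, ih (admissible_cons_zero.1 h)]
      simp
    · have he := (admissible_cons_one.1 h).1
      rw [narayanaValue_cons_one, ja_narayana_add ((narayanaValue_bounds e he).2 h),
        List.count_cons_self]
      have := ih he
      obtain h' | h' := fin_two_eq (ja (narayanaValue e)) <;> rw [h'] at this ⊢ <;>
        simp at this ⊢ <;> omega

/-! ### Periods and exponents of factors -/

section Periods

variable {α : Type*}

theorem isPeriod_block_iff (w : ℕ → α) (i n p : ℕ) : IsPeriod (block w i n) p ↔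
    1 ≤ p ∧ p ≤ n ∧ ∀ k < n - p, w (i + k) = w (i + p + k) := by
  have hl : (block w i n).length = n := by simp [block]
  rw [IsPeriod, hl]
  refine and_congr_right fun _ => and_congr_right fun hpn => ?_
  rw [List.ext_getElem_iff]
  simp only [List.length_drop, List.length_take, hl, List.getElem_drop, List.getElem_take]
  constructor
  · rintro ⟨-, h⟩ k hk
    have := h k hk (by omega)
    simp only [block, List.getElem_map, List.getElem_range] at this
    rw [Nat.add_assoc]
    exact this.symm
  · intro h
    refine ⟨by omega, fun k hk _ => ?_⟩
    simp only [block, List.getElem_map, List.getElem_range]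
    rw [← Nat.add_assoc]
    exact (h k hk).symm

theorem isPeriod_length {x : List α} (hx : x ≠ []) : IsPeriod x x.length :=
  ⟨List.length_pos_iff.2 hx, le_rfl, by simp⟩

theorem isPeriod_per {x : List α} (hx : x ≠ []) : IsPeriod x (per x) :=
  Nat.sInf_mem (s := {p | IsPeriod x p}) ⟨_, isPeriod_length hx⟩

theorem per_le {x : List α} {p : ℕ} (h : IsPeriod x p) : per x ≤ p :=
  Nat.sInf_le h

theorem isFactor_block (w : ℕ → α) (i n : ℕ) : IsFactor w (block w i n) :=
  ⟨i, by simp [block]⟩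

theorem minPer_le {w : ℕ → α} {x : List α} (h : IsFactor w x) : minPer w x.length ≤ per x :=
  Nat.sInf_le ⟨x, h, rfl, rfl⟩

theorem exists_per_eq_minPer (w : ℕ → α) (n : ℕ) :
    ∃ x, IsFactor w x ∧ x.length = n ∧ minPer w n = per x :=
  Nat.sInf_mem (s := {p | ∃ x, IsFactor w x ∧ x.length = n ∧ p = per x})
    ⟨_, block w 0 n, isFactor_block w 0 n, by simp [block], rfl⟩

end Periods

/-! ### Exponents of factors of `ja` -/

theorem length_le_of_isPeriod {x : List (Fin 2)} {p : ℕ} (hx : IsFactor ja x)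
    (hp : IsPeriod x p) : x.length ≤ 2 * p + 2 := by
  obtain ⟨i, hi⟩ := hx
  rw [hi, isPeriod_block_iff] at hp
  obtain ⟨h₁, -, h₂⟩ := hp
  by_contra hlt
  exact not_ja_long_repetition i p h₁ fun k hk => h₂ k (by omega)

theorem exists_long_factor (m : ℕ) :
    ∃ x : List (Fin 2), IsFactor ja x ∧ m < x.length ∧ x.length = 2 * per x + 2 := by
  obtain ⟨i, p, hp, h⟩ := exists_ja_repetition m
  have hl : (block ja i (2 * p + 2)).length = 2 * p + 2 := by simp [block]
  have hper : IsPeriod (block ja i (2 * p + 2)) p :=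
    (isPeriod_block_iff _ _ _ _).2 ⟨by omega, by omega, fun k hk => h k (by omega)⟩
  have hne : block ja i (2 * p + 2) ≠ [] := List.ne_nil_of_length_pos (by omega)
  have h₁ := per_le hper
  -- The upper bound applied to the smallest period shows that it is not below `p`.
  have h₂ := length_le_of_isPeriod (isFactor_block ja i (2 * p + 2)) (isPeriod_per hne)
  exact ⟨_, isFactor_block ja i (2 * p + 2), by omega, by omega⟩

theorem length_le_per {x : List (Fin 2)} (hx : IsFactor ja x) (hne : x ≠ []) :
    1 ≤ per x ∧ x.length ≤ 2 * per x + 2 :=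
  ⟨(isPeriod_per hne).1, length_le_of_isPeriod hx (isPeriod_per hne)⟩

theorem exponent_le_four {x : List (Fin 2)} (hx : IsFactor ja x) (hne : x ≠ []) :
    exponent x ≤ 4 := by
  obtain ⟨h₁, h₂⟩ := length_le_per hx hne
  have h₃ : (0 : ℝ) < per x := by exact_mod_cast h₁
  rw [exponent, div_le_iff₀ h₃]
  exact_mod_cast (show x.length ≤ 4 * per x by omega)

theorem exponent_replicate_four (a : Fin 2) : exponent [a, a, a, a] = 4 := by
  have h : per [a, a, a, a] = 1 :=
    le_antisymm (per_le ⟨le_rfl, by simp, rfl⟩) (isPeriod_per (by simp)).1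
  rw [exponent, h]
  norm_num

theorem isFactor_zeros : IsFactor ja [0, 0, 0, 0] := ⟨14, by decide +kernel⟩

theorem isFactor_ones : IsFactor ja [1, 1, 1, 1] := ⟨1, by decide +kernel⟩

theorem exponent_eq_four_iff (x : List (Fin 2)) :
    (IsFactor ja x ∧ x ≠ [] ∧ exponent x = 4) ↔ (x = [0, 0, 0, 0] ∨ x = [1, 1, 1, 1]) := by
  constructor
  · rintro ⟨hx, hne, he⟩
    obtain ⟨h₁, h₂⟩ := length_le_per hx hne
    have h₃ : (0 : ℝ) < per x := by exact_mod_cast h₁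
    rw [exponent, div_eq_iff h₃.ne'] at he
    have he' : x.length = 4 * per x := by exact_mod_cast he
    have hper := (isPeriod_per hne).2.2
    rw [show per x = 1 by omega] at hper
    have hlen : x.length = 4 := by omega
    match x with
    | [a, b, c, d] =>
      simp only [List.drop_one, List.tail_cons, List.length_cons, List.length_nil] at hper
      simp only [Nat.zero_add, Nat.reduceAdd, Nat.reduceSub, List.take_succ_cons, List.take_zero,
        List.cons.injEq, and_true] at hper
      obtain ⟨rfl, rfl, rfl⟩ := hper
      obtain rfl | rfl := fin_two_eq d <;> simp
  · rintro (rfl | rfl)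
    · exact ⟨isFactor_zeros, by simp, exponent_replicate_four 0⟩
    · exact ⟨isFactor_ones, by simp, exponent_replicate_four 1⟩

theorem criticalExponent_ja : criticalExponent ja = 4 := by
  apply le_antisymm
  · refine sSup_le ?_
    rintro e ⟨x, hx, hne, rfl⟩
    exact (EReal.coe_le_coe_iff (y := 4)).2 (exponent_le_four hx hne)
  · refine le_sSup ⟨_, isFactor_ones, by simp, ?_⟩
    rw [exponent_replicate_four]
    rfl

theorem asymptoticCriticalExponent_ja : asymptoticCriticalExponent ja = 2 := by
  apply le_antisymm
  · have hlim : Filter.Tendsto (fun n : ℕ => 2 + 4 / ((n : ℝ) - 2)) Filter.atTop (nhds 2) := by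
      have h₁ : Filter.Tendsto (fun n : ℕ => (n : ℝ) - 2) Filter.atTop Filter.atTop :=
        Filter.tendsto_atTop_add_const_right _ _ tendsto_natCast_atTop_atTop
      simpa using (h₁.const_div_atTop 4).const_add 2
    have hlim' : Filter.Tendsto (fun n : ℕ => ((2 + 4 / ((n : ℝ) - 2) : ℝ) : EReal))
        Filter.atTop (nhds ((2 : ℝ) : EReal)) :=
      (continuous_coe_real_ereal.tendsto 2).comp hlim
    refine le_trans (Filter.limsup_le_limsup ?_) hlim'.limsup_eq.le
    filter_upwards [Filter.eventually_ge_atTop 3] with n hn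
    obtain ⟨x, hx, hlen, hper⟩ := exists_per_eq_minPer ja n
    have hne : x ≠ [] := List.ne_nil_of_length_pos (by omega)
    obtain ⟨h₁, h₂⟩ := length_le_per hx hne
    rw [hlen, ← hper] at h₂
    rw [← hper] at h₁
    refine EReal.coe_le_coe_iff.2 ?_
    have h₃ : (1 : ℝ) ≤ minPer ja n := by exact_mod_cast h₁
    have h₄ : (n : ℝ) ≤ 2 * minPer ja n + 2 := by exact_mod_cast h₂
    have h₅ : (3 : ℝ) ≤ n := by exact_mod_cast hn
    have h₆ : 2 + 4 / ((n : ℝ) - 2) = 2 * n / (n - 2) := by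
      have : (n : ℝ) - 2 ≠ 0 := by linarith
      field_simp
      ring
    rw [h₆, div_le_div_iff₀ (by linarith) (by linarith)]
    nlinarith
  · refine Filter.le_limsup_of_frequently_le ?_
    rw [Filter.frequently_atTop]
    intro m
    obtain ⟨x, hx, hm, hlen⟩ := exists_long_factor m
    refine ⟨x.length, hm.le, ?_⟩
    have hle := minPer_le hx
    obtain ⟨y, hy, hylen, hper⟩ := exists_per_eq_minPer ja x.length
    have hne : y ≠ [] := List.ne_nil_of_length_pos (by omega)
    have h₁ := (length_le_per hy hne).1
    rw [← hper] at h₁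
    refine (EReal.coe_le_coe_iff (x := 2)).2 ?_
    rw [le_div_iff₀ (by exact_mod_cast h₁)]
    exact_mod_cast (show 2 * minPer ja x.length ≤ x.length by omega)

end AlloucheJohnson

theorem theorem41 :
    -- `ja` is the parity of the number of 1's in the (unique) Narayana representation
    (∀ m : ℕ, (∃! e : List (Fin 2), AlloucheJohnson.IsNarayanaRep e m) ∧
      ∀ e : List (Fin 2), AlloucheJohnson.IsNarayanaRep e m →
        (AlloucheJohnson.ja m : ℕ) = e.count 1 % 2) ∧
    -- the critical exponent is 4, attained exactly by 0000 and 1111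
    AlloucheJohnson.criticalExponent AlloucheJohnson.ja = 4 ∧
    (∀ x : List (Fin 2),
      (AlloucheJohnson.IsFactor AlloucheJohnson.ja x ∧ x ≠ [] ∧
        AlloucheJohnson.exponent x = 4) ↔ (x = [0, 0, 0, 0] ∨ x = [1, 1, 1, 1])) ∧
    -- the asymptotic critical exponent is 2
    AlloucheJohnson.asymptoticCriticalExponent AlloucheJohnson.ja = 2 ∧
    -- every factor of length `n` with period `p` satisfies `n ≤ 2p + 2`
    (∀ (x : List (Fin 2)) (p : ℕ), AlloucheJohnson.IsFactor AlloucheJohnson.ja x →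
      AlloucheJohnson.IsPeriod x p → x.length ≤ 2 * p + 2) ∧
    -- there are arbitrarily long factors with equality
    (∀ m : ℕ, ∃ x : List (Fin 2), AlloucheJohnson.IsFactor AlloucheJohnson.ja x ∧
      m < x.length ∧ x.length = 2 * AlloucheJohnson.per x + 2) := by
  exact ⟨fun m => ⟨AlloucheJohnson.existsUnique_isNarayanaRep m, fun e he => by
      rw [← he.1]
      exact AlloucheJohnson.ja_narayanaValue e he.2.2⟩,
    AlloucheJohnson.criticalExponent_ja, AlloucheJohnson.exponent_eq_four_iff,
    AlloucheJohnson.asymptoticCriticalExponent_ja,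
    fun _ _ => AlloucheJohnson.length_le_of_isPeriod, AlloucheJohnson.exists_long_factor⟩
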